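/- **Definitions.** A matroid $\mathcal M=(E,\mathcal I)$ has a finite ground set $E$ and rank function $\mathrm{rk}$. Its fractional covering number is $\beta_{\mathcal M}=\max_{\emptyset\ne A\subseteq E}|A|/\mathrm{rk}(A)$ (equal to $\infty$ if $\mathcal M$ has a loop, and to $0$ if $E=\emptyset$). For a nonempty finite sequence $\mathcal B=(B_1,\dots,B_t)$ of bases of $\mathcal M$, the load of $e\in E$ is the number of indices $i$ with $e\in B_i$, and its relative load is $\ell^{\mathcal B}(e)=|\{i: e\in B_i\}|/t$. The sequence is a greedy base collection if, for every $i$, $B_i$ is a minimum weight base for the weights given by the loads in $(B_1,\dots,B_{i-1})$. A dynamic matroid is a sequence $\mathcal M_0,\mathcal M_1,\dots$ of matroids in which each step is an update: either the deletion of an element $e$, which replaces $\mathcal M$ by its restriction to $E\setminus\{e\}$, or the insertion of a new element $e\notin E$, which replaces $\mathcal M$ by any matroid on $E\cup\{e\}$ whose restriction to $E$ is $\mathcal M$. A deterministic algorithm is given the initial ground set and then, one at a time, only the element inserted or deleted; it obtains all other information by adaptively querying ranks $\mathrm{rk}(A)$ in the current matroid. Only rank queries are counted, and queries made on the initial matroid,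 before the first update, are not counted. **Theorem.** There is an absolute constant $C>0$ such that for every $\varepsilon\in(0,1/2)$, every $n\in\mathbb N$ and every $\beta_{\max}\in\mathbb R$ there is a deterministic algorithm with the following property. For every dynamic matroid that at any moment has at most $n$ elements and covering number $\beta\le\beta_{\max}$, the algorithm makes at most $C\,\beta_{\max}^2\,\varepsilon^{-4}\log^3 n$ rank queries in each update (worst case), and at any moment (initially and after each update) it holds a greedy base collection $\mathcal B$ of the current matroid and outputs the value $$\tilde\beta=\frac{1}{\min_{e\in E}\ell^{\mathcal B}(e)}$$ (to be read as $0$ if $E=\emptyset$), which satisfies $$(1-\varepsilon)\,\beta\le\tilde\beta\le(1+\varepsilon)\,\beta ,$$ where $\beta$ is the covering number of the current matroid. -/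

import Mathlib

open scoped ENNReal NNReal

universe u

namespace DynMatroid

/-! ### Covering number, base collections -/

/-- The fractional covering number `max_{∅ ≠ A ⊆ E} |A| / rk A`. In `ℝ≥0∞` a nonempty set of rank
zero contributes `∞`, so the value is `∞` exactly when the (finite) matroid has a loop; the maximum
over the empty family (empty ground set) is `0`. -/
noncomputable def coveringNumber {α : Type u} (M : Matroid α) : ℝ≥0∞ :=
  ⨆ (A : Finset α) (_ : A.Nonempty) (_ : (A : Set α) ⊆ M.E),
    (A.card : ℝ≥0∞) / (M.eRk (A : Set α) : ℝ≥0∞)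

/-- The load of `e` in a family of sets: the number of members (with multiplicity) containing
`e`. -/
def load {α : Type u} [DecidableEq α] (𝓑 : List (Finset α)) (e : α) : ℕ :=
  𝓑.countP (fun B => e ∈ B)

/-- The relative load `load e / |𝓑|`. -/
noncomputable def relLoad {α : Type u} [DecidableEq α] (𝓑 : List (Finset α)) (e : α) : ℝ≥0∞ :=
  (load 𝓑 e : ℝ≥0∞) / (𝓑.length : ℝ≥0∞)

/-- The minimum relative load of an element of the ground set (`∞` if the ground set is empty). -/
noncomputable def minRelLoad {α : Type u} [DecidableEq α] (M : Matroid α)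
    (𝓑 : List (Finset α)) : ℝ≥0∞ :=
  ⨅ e ∈ M.E, relLoad 𝓑 e

/-- `B` is a base of `M` of minimum total weight. -/
def IsMinWeightBase {α : Type u} (M : Matroid α) (w : α → ℕ) (B : Finset α) : Prop :=
  M.IsBase (B : Set α) ∧
    ∀ B' : Finset α, M.IsBase (B' : Set α) → ∑ e ∈ B, w e ≤ ∑ e ∈ B', w e

/-- A greedy base collection: a nonempty sequence of bases, each of which is a minimum weight base,
the weight of an element being its load in the part of the sequence that comes before. -/
def IsGreedyBaseCollection {α : Type u} [DecidableEq α] (M : Matroid α)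
    (𝓑 : List (Finset α)) : Prop :=
  𝓑 ≠ [] ∧ ∀ (i : ℕ) (hi : i < 𝓑.length), IsMinWeightBase M (load (𝓑.take i)) 𝓑[i]

/-! ### Dynamic matroids -/

/-- An update announces the element that is inserted or deleted, and nothing else. -/
inductive Update (α : Type u) : Type u
  | insert (e : α)
  | delete (e : α)

/-- `U.Step M M'`: the update `U` may turn `M` into `M'`. A deletion restricts the matroid to the
remaining elements. An insertion adds a new element `e`, the new matroid being any matroid on the
enlarged ground set whose independent sets avoiding `e` are the old independent sets. -/
def Update.Step {α : Type u} : Update α → Matroid α → Matroid α → Prop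
  | .insert e, M, M' => e ∉ M.E ∧ M'.E = M.E ∪ {e} ∧ M'.delete {e} = M
  | .delete e, M, M' => e ∈ M.E ∧ M' = M.delete {e}

/-! ### Deterministic algorithms with a rank oracle -/

/-- A deterministic procedure that adaptively asks a rank oracle about finite sets and returns an
element of `σ`: each next step may depend on all answers received so far. -/
inductive RankProc (α : Type u) (σ : Type u) : Type u
  | done (s : σ) : RankProc α σ
  | query (A : Finset α) (next : ℕ → RankProc α σ) : RankProc α σ

/-- The element returned when queries are answered by `r`. -/
def RankProc.result {α σ : Type u} (r : Finset α → ℕ) : RankProc α σ → σ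
  | .done s => s
  | .query A next => (next (r A)).result r

/-- The number of queries made when queries are answered by `r`. -/
def RankProc.queries {α σ : Type u} (r : Finset α → ℕ) : RankProc α σ → ℕ
  | .done _ => 0
  | .query A next => (next (r A)).queries r + 1

/-- The rank oracle of a finite matroid. (A set that is not contained in the ground set is answered
by the rank of its intersection with the ground set.) -/
noncomputable def rankOracle {α : Type u} (M : Matroid α) (A : Finset α) : ℕ :=
  (M.eRk (A : Set α)).toNat

/-- A deterministic dynamic algorithm. It is told the initial ground set and then the updates, one
at a time; everything else it learns about the matroid through rank queries to the current matroid.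
It keeps a state between the updates, from which a collection of sets and a value are read off
without queries. -/
structure DynAlgorithm (α : Type u) where
  State : Type u
  init : Finset α → RankProc α State
  update : State → Update α → RankProc α State
  collection : State → List (Finset α)
  value : State → ℝ≥0

/-- The state after the first `i` updates, for the initial ground set `E₀`, the updates
`U 0, U 1, …` and the successive matroids `M 0, M 1, …`. -/
noncomputable def DynAlgorithm.stateAt {α : Type u} (𝒜 : DynAlgorithm α) (E₀ : Finset α)
    (M : ℕ → Matroid α) (U : ℕ → Update α) : ℕ → 𝒜.State
  | 0 => (𝒜.init E₀).result (rankOracle (M 0))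
  | i + 1 => (𝒜.update (𝒜.stateAt E₀ M U i) (U i)).result (rankOracle (M (i + 1)))

/-- The number of rank queries made while processing the update `U i`. -/
noncomputable def DynAlgorithm.queriesAt {α : Type u} (𝒜 : DynAlgorithm α) (E₀ : Finset α)
    (M : ℕ → Matroid α) (U : ℕ → Update α) (i : ℕ) : ℕ :=
  (𝒜.update (𝒜.stateAt E₀ M U i) (U i)).queries (rankOracle (M (i + 1)))

end DynMatroid

/-!
The algorithm maintains one canonical greedy base collection. Ties between equal loads are broken by
a fixed well-order, so the minimum weight base for given weights is determined: it consists of the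
elements not spanned by the elements that precede them (`greedyBase`). Such a base contains a basis
of every initial segment of the weight order, and all facts about it come from this.

*Approximation.* By averaging over `A`, the minimum relative load is at most `rk A / |A|` for every
`A`, so its inverse is at least `β` (`coveringNumber_le_inv_minRelLoad`). Conversely, the greedy
base for the loads is also one of maximum weight for the weights `(1 - δ) ^ load`; summing over the
layers `{load ≤ s}`, each of which has rank at least `1 / β` times its size, shows that it carries at least
the fraction `1 / β` of the total mass (`sum_pow_le_mul_sum_greedyBase`). Hence the potential
`∑ (1 - δ) ^ load` shrinks by the factor `1 - δ / β` with every base, and once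
`t ≥ 16 β log n / ε ^ 2`, where `δ = ε / 4`, every load is at least `t / ((1 + ε) β)`
(`le_mul_load_greedySeq`).

*Recourse.* Compare the greedy sequences of `M` and of `M ＼ {e}`. By induction, each load of an
element other than `e` is at least as large in `M ＼ {e}`: an element whose two loads agree has fewer
predecessors after the deletion, so it is still chosen if it was chosen before
(`mem_greedyBase_delete`). Since the loads of `i` bases add up to `i` times the rank, which does not
grow, the total increase is at most the load of `e`, so at most `i` loads differ after `i` bases
(`card_changed_le`). Therefore, up to at most `i + 1` known elements, the next base for `M` is
contained in the next base for `M ＼ {e}`.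

*Queries.* After a deletion, the new base thus contains a known set that misses at most `i + 1` of
its elements; after an insertion, it is contained in a known set with at most `i + 1` further
elements. The missing or superfluous elements are found one by one, the first in weight order each
time, by binary search with about `log₂ n` rank queries (`result_completeProc`, `result_pruneProc`).
Over `t` bases this adds up to at most `t ^ 2 * (⌈log₂ n⌉ + 1)` queries per update.
-/

namespace DynMatroid

/-! ### Greedy bases for a weight order with fixed tie-breaking -/

/-- The strict total order by weight, ties being broken by a fixed well-order of the type. -/
def Precedes {α : Type u} (w : α → ℕ) (f g : α) : Prop :=
  w f < w g ∨ w f = w g ∧ WellOrderingRel f g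

open Classical in
/-- The elements of `E` that strictly precede `f`. -/
noncomputable def preds {α : Type u} (E : Finset α) (w : α → ℕ) (f : α) : Finset α :=
  E.filter (fun g => Precedes w g f)

/-- The position of `f` in `E`, counted from `0`. -/
noncomputable def pos {α : Type u} (E : Finset α) (w : α → ℕ) (f : α) : ℕ :=
  (preds E w f).card

open Classical in
/-- The base chosen by the greedy algorithm: the elements that are not spanned by the elements
preceding them. -/
noncomputable def greedyBase {α : Type u} (M : Matroid α) (E : Finset α) (w : α → ℕ) : Finset α :=
  E.filter (fun f => f ∉ M.closure (preds E w f : Set α))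

section order
variable {α : Type u} {E : Finset α} {w : α → ℕ} {f g : α}

lemma Precedes.trans {h : α} (h₁ : Precedes w f g) (h₂ : Precedes w g h) : Precedes w f h := by
  rcases h₁ with h₁ | ⟨h₁, h₁'⟩ <;> rcases h₂ with h₂ | ⟨h₂, h₂'⟩
  · exact Or.inl (h₁.trans h₂)
  · exact Or.inl (h₂ ▸ h₁)
  · exact Or.inl (h₁ ▸ h₂)
  · exact Or.inr ⟨h₁.trans h₂, _root_.trans h₁' h₂'⟩

lemma not_precedes_self : ¬ Precedes w f f := by
  rintro (h | ⟨-, h⟩)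
  · exact lt_irrefl _ h
  · exact irrefl _ h

lemma precedes_or_precedes (hfg : f ≠ g) : Precedes w f g ∨ Precedes w g f := by
  rcases lt_trichotomy (w f) (w g) with h | h | h
  · exact Or.inl (Or.inl h)
  · rcases trichotomous_of WellOrderingRel f g with h' | h' | h'
    · exact Or.inl (Or.inr ⟨h, h'⟩)
    · exact absurd h' hfg
    · exact Or.inr (Or.inr ⟨h.symm, h'⟩)
  · exact Or.inr (Or.inl h)

lemma mem_preds : g ∈ preds E w f ↔ g ∈ E ∧ Precedes w g f := by
  classical exact Finset.mem_filter

lemma pos_lt_pos (hf : f ∈ E) (h : Precedes w f g) : pos E w f < pos E w g := by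
  refine Finset.card_lt_card ⟨fun x hx => ?_, fun hs => ?_⟩
  · exact mem_preds.2 ⟨(mem_preds.1 hx).1, (mem_preds.1 hx).2.trans h⟩
  · exact not_precedes_self (mem_preds.1 (hs (mem_preds.2 ⟨hf, h⟩))).2

lemma pos_lt_pos_iff (hf : f ∈ E) (hg : g ∈ E) : pos E w f < pos E w g ↔ Precedes w f g := by
  refine ⟨fun h => ?_, pos_lt_pos hf⟩
  by_contra hn
  rcases eq_or_ne f g with rfl | hfg
  · exact lt_irrefl _ h
  · exact lt_asymm h (pos_lt_pos hg ((precedes_or_precedes hfg).resolve_left hn))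

lemma pos_injOn : Set.InjOn (pos E w) E := by
  intro f hf g hg h
  by_contra hfg
  rcases precedes_or_precedes (w := w) hfg with h' | h'
  · exact (pos_lt_pos hf h').ne h
  · exact (pos_lt_pos hg h').ne h.symm

lemma pos_lt_card (hf : f ∈ E) : pos E w f < E.card := by
  refine Finset.card_lt_card ⟨fun x hx => (mem_preds.1 hx).1, fun hs => ?_⟩
  exact not_precedes_self (mem_preds.1 (hs hf)).2

end order

section greedy
variable {α : Type u} {M : Matroid α} {E : Finset α} {w : α → ℕ} {f : α}

lemma mem_greedyBase :
    f ∈ greedyBase M E w ↔ f ∈ E ∧ f ∉ M.closure (preds E w f : Set α) := by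
  classical exact Finset.mem_filter

lemma greedyBase_subset : greedyBase M E w ⊆ E := fun _ h => (mem_greedyBase.1 h).1

/-- The last element of a circuit is spanned by its predecessors, so it is not chosen. -/
lemma greedyBase_indep (hE : M.E = E) : M.Indep (greedyBase M E w : Set α) := by
  by_contra hI
  have hsub : (greedyBase M E w : Set α) ⊆ M.E := hE ▸ Finset.coe_subset.2 greedyBase_subset
  obtain ⟨C, hCs, hC⟩ := (Matroid.not_indep_iff (hX := hsub)).1 hI |>.exists_isCircuit_subset
  have hfin : C.Finite := (Finset.finite_toSet _).subset hCs
  obtain ⟨f, hfC, hmax⟩ := Set.exists_max_image C (pos E w) hfin hC.nonempty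
  refine (mem_greedyBase.1 (hCs hfC)).2 ?_
  refine M.closure_subset_closure ?_ (hC.mem_closure_sdiff_singleton_of_mem hfC)
  rintro g ⟨hgC, hgf⟩
  have hg : g ∈ E := greedyBase_subset (hCs hgC)
  have hf : f ∈ E := greedyBase_subset (hCs hfC)
  refine mem_preds.2 ⟨hg, (pos_lt_pos_iff hg hf).1 ?_⟩
  exact lt_of_le_of_ne (hmax g hgC) (fun h => hgf (pos_injOn hg hf h))

/-- The greedy base contains a basis of every initial segment of the weight order. -/
lemma greedyBase_inter_isBasis (hE : M.E = E) {P : Finset α} (hP : P ⊆ E)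
    (hdown : ∀ f ∈ P, ∀ g ∈ E, Precedes w g f → g ∈ P) :
    M.IsBasis ((greedyBase M E w : Set α) ∩ P) P := by
  refine ((greedyBase_indep hE).subset Set.inter_subset_left).isBasis_of_subset_of_subset_closure
    Set.inter_subset_right ?_
  intro f
  induction hn : pos E w f using Nat.strong_induction_on generalizing f with
  | _ n ih =>
    subst hn
    intro hf
    have hBE : ((greedyBase M E w : Set α) ∩ P) ⊆ M.E :=
      hE ▸ Set.inter_subset_right.trans (Finset.coe_subset.2 hP)
    by_cases hfB : f ∈ greedyBase M E w
    · exact M.subset_closure _ hBE ⟨hfB, hf⟩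
    · have hfc : f ∈ M.closure (preds E w f : Set α) := by
        by_contra h
        exact hfB (mem_greedyBase.2 ⟨hP hf, h⟩)
      refine M.closure_subset_closure_of_subset_closure ?_ hfc
      intro g hg
      have hg' := mem_preds.1 hg
      exact ih _ (pos_lt_pos hg'.1 hg'.2) rfl (hdown f hf g hg'.1 hg'.2)

lemma greedyBase_isBase (hE : M.E = E) : M.IsBase (greedyBase M E w : Set α) := by
  have h := greedyBase_inter_isBasis (w := w) hE (Finset.Subset.refl E) (fun _ _ g hg _ => hg)
  rw [Set.inter_eq_self_of_subset_left (Finset.coe_subset.2 greedyBase_subset), ← hE] at h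
  exact Matroid.isBasis_ground_iff.1 h

end greedy

/-! ### Ranks and weights of greedy bases -/

section rank
variable {α : Type u} {M : Matroid α} {E : Finset α} {w : α → ℕ} {f : α}

lemma coe_rankOracle (M : Matroid α) (A : Finset α) :
    (rankOracle M A : ℕ∞) = M.eRk (A : Set α) := by
  apply ENat.natCast_toNat
  exact ((M.eRk_le_encard _).trans_lt (by simp [Set.encard_coe_eq_coe_finsetCard])).ne

lemma rankOracle_le_card (M : Matroid α) (A : Finset α) : rankOracle M A ≤ A.card := by
  have h := M.eRk_le_encard (A : Set α)
  rw [← coe_rankOracle, Set.encard_coe_eq_coe_finsetCard] at h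
  exact_mod_cast h

lemma rankOracle_mono (M : Matroid α) {A B : Finset α} (h : A ⊆ B) :
    rankOracle M A ≤ rankOracle M B := by
  have h' := M.eRk_mono (Finset.coe_subset.2 h)
  rw [← coe_rankOracle, ← coe_rankOracle] at h'
  exact_mod_cast h'

lemma card_le_rankOracle {I A : Finset α} (hI : M.Indep (I : Set α)) (h : I ⊆ A) :
    I.card ≤ rankOracle M A := by
  have h' := hI.encard_le_eRk_of_subset (Finset.coe_subset.2 h)
  rw [← coe_rankOracle, Set.encard_coe_eq_coe_finsetCard] at h'
  exact_mod_cast h'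

lemma card_eq_rankOracle_of_isBase (hE : M.E = E) {B : Finset α} (hB : M.IsBase (B : Set α)) :
    B.card = rankOracle M E := by
  have h := hB.encard_eq_eRank
  rw [← M.eRk_ground, hE, ← coe_rankOracle, Set.encard_coe_eq_coe_finsetCard] at h
  exact_mod_cast h

lemma card_greedyBase (hE : M.E = E) : (greedyBase M E w).card = rankOracle M E :=
  card_eq_rankOracle_of_isBase hE (greedyBase_isBase hE)

lemma card_greedyBase_filter_le (hE : M.E = E) (s : ℕ) :
    ((greedyBase M E w).filter (fun e => w e ≤ s)).card =
      rankOracle M (E.filter (fun e => w e ≤ s)) := by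
  have h := greedyBase_inter_isBasis (w := w) hE (Finset.filter_subset (fun e => w e ≤ s) E) (by
    intro f hf g hg hgf
    rw [Finset.mem_filter] at hf ⊢
    refine ⟨hg, le_trans ?_ hf.2⟩
    rcases hgf with h | h
    exacts [h.le, h.1.le])
  have h2 := h.eRk_eq_encard
  have h3 : ((greedyBase M E w : Set α) ∩ (E.filter (fun e => w e ≤ s) : Finset α)) =
      ((greedyBase M E w).filter (fun e => w e ≤ s) : Finset α) := by
    ext x
    simp only [Set.mem_inter_iff, Finset.mem_coe, Finset.mem_filter]
    exact ⟨fun h => ⟨h.1, h.2.2⟩, fun h => ⟨h.1, greedyBase_subset h.1, h.2⟩⟩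
  rw [h3, ← coe_rankOracle, Set.encard_coe_eq_coe_finsetCard] at h2
  exact_mod_cast h2.symm

/-- Layer-cake formula for a weight bounded by `W`. -/
lemma sum_eq_sum_card_filter (B : Finset α) (w : α → ℕ) {W : ℕ} (hW : ∀ e ∈ B, w e ≤ W) :
    ∑ e ∈ B, w e = ∑ s ∈ Finset.range W, (B.card - (B.filter (fun e => w e ≤ s)).card) := by
  have h1 : ∀ s, B.card - (B.filter (fun e => w e ≤ s)).card
      = ∑ e ∈ B, if s < w e then 1 else 0 := by
    intro s
    rw [← Finset.card_filter]
    have := Finset.card_filter_add_card_filter_not (s := B) (fun e => w e ≤ s)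
    simp only [not_le] at this
    omega
  simp_rw [h1]
  rw [Finset.sum_comm]
  refine Finset.sum_congr rfl fun e he => ?_
  rw [← Finset.card_filter]
  have : (Finset.range W).filter (fun s => s < w e) = Finset.range (w e) := by
    ext s
    simp only [Finset.mem_filter, Finset.mem_range]
    have := hW e he
    omega
  rw [this, Finset.card_range]

lemma greedyBase_isMinWeightBase (hE : M.E = E) : IsMinWeightBase M w (greedyBase M E w) := by
  refine ⟨greedyBase_isBase hE, fun B' hB' => ?_⟩
  have hB'E : B' ⊆ E := by
    have := hB'.subset_ground
    rw [hE] at this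
    exact_mod_cast this
  have hW : ∀ e ∈ E, w e ≤ E.sup w := fun e he => Finset.le_sup he
  rw [sum_eq_sum_card_filter _ w (fun e he => hW e (greedyBase_subset he)),
    sum_eq_sum_card_filter _ w (fun e he => hW e (hB'E he))]
  refine Finset.sum_le_sum fun s _ => ?_
  rw [card_greedyBase_filter_le hE, card_greedyBase hE, card_eq_rankOracle_of_isBase hE hB']
  refine Nat.sub_le_sub_left (card_le_rankOracle (hB'.indep.subset ?_) ?_) _
  · exact Finset.coe_subset.2 (Finset.filter_subset _ _)
  · exact Finset.filter_subset_filter _ hB'E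

/-- If `|A| ≤ b * rk A` for all `A`, then the greedy base carries at least the fraction `1 / b` of
the total mass of the weights `q ^ w`. -/
lemma sum_pow_le_mul_sum_greedyBase (hE : M.E = E) {b q : ℝ} (hq0 : 0 ≤ q) (hq1 : q ≤ 1)
    (hb : ∀ A ⊆ E, (A.card : ℝ) ≤ b * rankOracle M A) :
    ∑ e ∈ E, q ^ w e ≤ b * ∑ e ∈ greedyBase M E w, q ^ w e := by
  set W := E.sup w
  have hW : ∀ e ∈ E, w e ≤ W := fun e he => Finset.le_sup he
  have key : ∀ B : Finset α, B ⊆ E → ∑ e ∈ B, q ^ w e = q ^ W * B.card +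
      ∑ s ∈ Finset.range W, (q ^ s - q ^ (s + 1)) * (B.filter (fun e => w e ≤ s)).card := by
    intro B hB
    simp_rw [Finset.card_filter, Nat.cast_sum, Finset.mul_sum]
    rw [Finset.sum_comm, Finset.card_eq_sum_ones, Nat.cast_sum, Finset.mul_sum,
      ← Finset.sum_add_distrib]
    refine Finset.sum_congr rfl fun e he => ?_
    have hwe := hW e (hB he)
    have : ∀ s, (q ^ s - q ^ (s + 1)) * ((if w e ≤ s then 1 else 0 : ℕ) : ℝ)
        = if w e ≤ s then q ^ s - q ^ (s + 1) else 0 := by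
      intro s; split_ifs <;> simp
    simp_rw [this]
    rw [← Finset.sum_filter]
    have h2 : (Finset.range W).filter (fun s => w e ≤ s) = Finset.Ico (w e) W := by
      ext s
      simp only [Finset.mem_filter, Finset.mem_range, Finset.mem_Ico]
      tauto
    rw [h2]
    have h3 := Finset.sum_Ico_sub (fun s => q ^ s) hwe
    have h4 : ∑ s ∈ Finset.Ico (w e) W, (q ^ s - q ^ (s + 1))
        = - ∑ s ∈ Finset.Ico (w e) W, (q ^ (s + 1) - q ^ s) := by
      rw [← Finset.sum_neg_distrib]
      exact Finset.sum_congr rfl fun _ _ => by ring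
    rw [h4, h3]
    push_cast
    ring
  rw [key E (Finset.Subset.refl E), key _ greedyBase_subset, mul_add, Finset.mul_sum,
    card_greedyBase hE]
  refine add_le_add ?_ (Finset.sum_le_sum fun s _ => ?_)
  · have := mul_le_mul_of_nonneg_left (hb E (Finset.Subset.refl E)) (pow_nonneg hq0 W)
    linarith
  · rw [card_greedyBase_filter_le hE]
    have h0 : 0 ≤ q ^ s - q ^ (s + 1) :=
      sub_nonneg.2 (pow_le_pow_of_le_one hq0 hq1 (Nat.le_succ s))
    have := mul_le_mul_of_nonneg_left (hb _ (Finset.filter_subset (fun e => w e ≤ s) E)) h0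
    linarith

lemma card_le_toReal_coveringNumber_mul (hE : M.E = E) (hβ : coveringNumber M ≠ ⊤)
    {A : Finset α} (hA : A ⊆ E) :
    (A.card : ℝ) ≤ (coveringNumber M).toReal * rankOracle M A := by
  rcases A.eq_empty_or_nonempty with rfl | hne
  · simp only [Finset.card_empty, Nat.cast_zero]; positivity
  have h : (A.card : ℝ≥0∞) / (M.eRk (A : Set α) : ℝ≥0∞) ≤ coveringNumber M := by
    refine le_iSup_of_le A (le_iSup_of_le hne (le_iSup_of_le ?_ le_rfl))
    rw [hE]; exact Finset.coe_subset.2 hA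
  rw [← coe_rankOracle, ENat.toENNReal_coe,
    ENNReal.div_le_iff_le_mul (Or.inr hβ) (Or.inl (ENNReal.natCast_ne_top _))] at h
  have h' := ENNReal.toReal_mono (ENNReal.mul_ne_top hβ (ENNReal.natCast_ne_top _)) h
  simpa using h'

lemma one_le_toReal_coveringNumber (hE : M.E = E) (hβ : coveringNumber M ≠ ⊤) (hne : E.Nonempty) :
    1 ≤ (coveringNumber M).toReal := by
  have h := card_le_toReal_coveringNumber_mul hE hβ (Finset.Subset.refl E)
  have h1 : (rankOracle M E : ℝ) ≤ E.card := by exact_mod_cast rankOracle_le_card M E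
  have h2 : (0 : ℝ) < E.card := by exact_mod_cast Finset.card_pos.2 hne
  have h3 : (coveringNumber M).toReal * rankOracle M E ≤ (coveringNumber M).toReal * E.card :=
    mul_le_mul_of_nonneg_left h1 ENNReal.toReal_nonneg
  by_contra hlt
  nlinarith

lemma toReal_coveringNumber_le (hE : M.E = E) (hne : E.Nonempty) {βmax : ℝ}
    (hβ : coveringNumber M ≤ ENNReal.ofReal βmax) : (coveringNumber M).toReal ≤ βmax := by
  refine ENNReal.toReal_le_of_le_ofReal ?_ hβ
  by_contra hneg
  have hb1 := one_le_toReal_coveringNumber hE (ne_top_of_le_ne_top ENNReal.ofReal_ne_top hβ) hne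
  rw [ENNReal.ofReal_of_nonpos (not_le.1 hneg).le, nonpos_iff_eq_zero] at hβ
  rw [hβ] at hb1
  norm_num at hb1

/-- A loopless matroid with at most one element is free. -/
lemma greedyBase_eq_ground_of_card_le_one (hE : M.E = E) (hβ : coveringNumber M ≠ ⊤)
    (h1 : E.card ≤ 1) (w : α → ℕ) : greedyBase M E w = E := by
  refine Finset.eq_of_subset_of_card_le greedyBase_subset ?_
  rw [card_greedyBase hE]
  by_contra hlt
  have h0 : rankOracle M E = 0 := by omega
  have h := card_le_toReal_coveringNumber_mul hE hβ (Finset.Subset.refl E)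
  rw [h0, Nat.cast_zero, mul_zero] at h
  have : E.card ≤ 0 := by exact_mod_cast h
  omega

end rank


/-! ### The greedy sequence of bases and its loads -/

/-- The canonical greedy base collection: each term is the greedy base for the loads so far. -/
noncomputable def greedySeq {α : Type u} [DecidableEq α] (M : Matroid α) (E : Finset α) :
    ℕ → List (Finset α)
  | 0 => []
  | i + 1 => greedySeq M E i ++ [greedyBase M E (load (greedySeq M E i))]

section seq
variable {α : Type u} [DecidableEq α] {M : Matroid α} {E : Finset α}

lemma length_greedySeq (i : ℕ) : (greedySeq M E i).length = i := by
  induction i with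
  | zero => rfl
  | succ i ih => simp [greedySeq, ih]

lemma take_greedySeq {i t : ℕ} (h : i ≤ t) : (greedySeq M E t).take i = greedySeq M E i := by
  induction t, h using Nat.le_induction with
  | base => rw [List.take_of_length_le (length_greedySeq i).le]
  | succ t hit ih => rw [greedySeq, List.take_append_of_le_length (by rwa [length_greedySeq]), ih]

lemma getElem_greedySeq {i t : ℕ} (h : i < (greedySeq M E t).length) :
    (greedySeq M E t)[i] = greedyBase M E (load (greedySeq M E i)) := by
  have hit : i + 1 ≤ t := by rwa [length_greedySeq] at h
  have h1 : ((greedySeq M E t).take (i + 1))[i]'(by simp; omega) = (greedySeq M E t)[i] :=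
    List.getElem_take
  rw [← h1]
  simp only [take_greedySeq hit, greedySeq]
  rw [List.getElem_append_right (length_greedySeq i).le]
  simp

lemma greedySeq_isGreedyBaseCollection (hE : M.E = E) {t : ℕ} (ht : t ≠ 0) :
    IsGreedyBaseCollection M (greedySeq M E t) := by
  refine ⟨fun h => ht ?_, fun i hi => ?_⟩
  · rw [← length_greedySeq (M := M) (E := E) t, h, List.length_nil]
  · rw [getElem_greedySeq, take_greedySeq (by rw [length_greedySeq] at hi; exact hi.le)]
    exact greedyBase_isMinWeightBase hE

lemma load_greedySeq_succ (i : ℕ) (e : α) :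
    load (greedySeq M E (i + 1)) e = load (greedySeq M E i) e +
      if e ∈ greedyBase M E (load (greedySeq M E i)) then 1 else 0 := by
  simp [load, greedySeq, List.countP_append, List.countP_singleton]

lemma sum_load_greedySeq (hE : M.E = E) (i : ℕ) :
    ∑ e ∈ E, load (greedySeq M E i) e = i * rankOracle M E := by
  induction i with
  | zero => simp [greedySeq, load]
  | succ i ih =>
    simp_rw [load_greedySeq_succ, Finset.sum_add_distrib, ih]
    rw [← Finset.card_filter, Finset.filter_mem_eq_inter,
      Finset.inter_eq_right.2 greedyBase_subset, card_greedyBase hE]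
    ring

lemma sum_load_greedySeq_le (hE : M.E = E) (A : Finset α) (i : ℕ) :
    ∑ e ∈ A, load (greedySeq M E i) e ≤ i * rankOracle M A := by
  induction i with
  | zero => simp [greedySeq, load]
  | succ i ih =>
    simp_rw [load_greedySeq_succ, Finset.sum_add_distrib]
    rw [← Finset.card_filter, Finset.filter_mem_eq_inter, Nat.succ_mul]
    refine add_le_add ih (card_le_rankOracle
      ((greedyBase_indep hE (w := load (greedySeq M E i))).subset ?_)
      Finset.inter_subset_left)
    exact Finset.coe_subset.2 Finset.inter_subset_right

/-! ### Relative loads approximate the covering number -/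

/-- One greedy base diminishes the potential `∑ (1 - δ) ^ load` by the factor `1 - δ / b`. -/
lemma sum_pow_load_le (hE : M.E = E) {b δ : ℝ} (hb0 : 0 < b) (hbδ : δ ≤ b) (hδ0 : 0 ≤ δ)
    (hδ1 : δ ≤ 1) (hb : ∀ A ⊆ E, (A.card : ℝ) ≤ b * rankOracle M A) (t : ℕ) :
    ∑ e ∈ E, (1 - δ) ^ load (greedySeq M E t) e ≤ E.card * (1 - δ / b) ^ t := by
  induction t with
  | zero => simp [greedySeq, load]
  | succ t ih =>
    set w := load (greedySeq M E t) with hw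
    have h1 : ∑ e ∈ E, (1 - δ) ^ load (greedySeq M E (t + 1)) e
        = ∑ e ∈ E, (1 - δ) ^ w e - δ * ∑ e ∈ greedyBase M E w, (1 - δ) ^ w e := by
      rw [← Finset.inter_eq_right.2 (greedyBase_subset (M := M) (E := E) (w := w)),
        ← Finset.filter_mem_eq_inter, Finset.sum_filter, Finset.mul_sum,
        ← Finset.sum_sub_distrib]
      refine Finset.sum_congr rfl fun e _ => ?_
      rw [load_greedySeq_succ, ← hw]
      split_ifs <;> ring
    have h2 := sum_pow_le_mul_sum_greedyBase (w := w) hE (sub_nonneg.2 hδ1)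
      (by linarith : 1 - δ ≤ 1) hb
    have h3 : (∑ e ∈ E, (1 - δ) ^ w e) / b ≤ ∑ e ∈ greedyBase M E w, (1 - δ) ^ w e := by
      rwa [div_le_iff₀' hb0]
    have h4 : 0 ≤ 1 - δ / b := sub_nonneg.2 ((div_le_one hb0).2 hbδ)
    calc _ = ∑ e ∈ E, (1 - δ) ^ w e - δ * ∑ e ∈ greedyBase M E w, (1 - δ) ^ w e := h1
      _ ≤ ∑ e ∈ E, (1 - δ) ^ w e - δ * ((∑ e ∈ E, (1 - δ) ^ w e) / b) := by gcongr
      _ = (∑ e ∈ E, (1 - δ) ^ w e) * (1 - δ / b) := by ring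
      _ ≤ (E.card * (1 - δ / b) ^ t) * (1 - δ / b) := by gcongr
      _ = _ := by ring

/-- A long greedy sequence loads every element nearly `t / b` times. -/
lemma le_mul_load_greedySeq (hE : M.E = E) {b ε : ℝ} (hb1 : 1 ≤ b) (hε0 : 0 < ε) (hε1 : ε < 1 / 2)
    (hb : ∀ A ⊆ E, (A.card : ℝ) ≤ b * rankOracle M A) {n t : ℕ} (hn : E.card ≤ n)
    (ht : 16 * b * Real.log n / ε ^ 2 ≤ t) {e : α} (he : e ∈ E) :
    (t : ℝ) ≤ (1 + ε) * b * load (greedySeq M E t) e := by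
  -- with this `δ`, the two losses of a factor `1 - δ` below cost at most `1 + ε` together
  set δ := ε / 4 with hδ
  have hδ0 : 0 < δ := by positivity
  have hδ1 : δ < 1 / 8 := by rw [hδ]; linarith
  have hεδ : ε = 4 * δ := by rw [hδ]; ring
  have hb0 : 0 < b := by linarith
  set m := load (greedySeq M E t) e
  have hcard : 0 < E.card := Finset.card_pos.2 ⟨e, he⟩
  have hcard' : (0 : ℝ) < E.card := by exact_mod_cast hcard
  have h1δ : 0 < 1 - δ := by linarith
  have hpow : (1 - δ) ^ m ≤ n * Real.exp (-(δ / b)) ^ t := by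
    calc (1 - δ) ^ m ≤ ∑ e ∈ E, (1 - δ) ^ load (greedySeq M E t) e :=
          Finset.single_le_sum (f := fun e => (1 - δ) ^ load (greedySeq M E t) e)
            (fun _ _ => (pow_pos h1δ _).le) he
      _ ≤ E.card * (1 - δ / b) ^ t :=
          sum_pow_load_le hE hb0 (by linarith) hδ0.le (by linarith) hb t
      _ ≤ n * Real.exp (-(δ / b)) ^ t := by
          have h0 : 0 ≤ 1 - δ / b := sub_nonneg.2 ((div_le_one hb0).2 (by linarith))
          have h1 : 1 - δ / b ≤ Real.exp (-(δ / b)) := Real.one_sub_le_exp_neg _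
          gcongr
  have hn0 : (0 : ℝ) < n := hcard'.trans_le (by exact_mod_cast hn)
  have hlog : m * Real.log (1 - δ) ≤ Real.log n - t * (δ / b) := by
    have h := Real.log_le_log (pow_pos h1δ _) hpow
    rw [Real.log_pow, Real.log_mul hn0.ne' (pow_pos (Real.exp_pos _) _).ne', Real.log_pow,
      Real.log_exp] at h
    linarith
  have hlog2 : -(δ / (1 - δ)) ≤ Real.log (1 - δ) := by
    have h := Real.one_sub_inv_le_log_of_pos h1δ
    have h' : 1 - (1 - δ)⁻¹ = -(δ / (1 - δ)) := by field_simp; ring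
    linarith
  have hm : t * (δ / b) - Real.log n ≤ m * (δ / (1 - δ)) := by
    have := mul_le_mul_of_nonneg_left hlog2 (Nat.cast_nonneg m : (0 : ℝ) ≤ m)
    linarith
  have hln : Real.log n ≤ t * (δ ^ 2 / b) := by
    rw [div_le_iff₀ (by positivity)] at ht
    rw [mul_div_assoc', le_div_iff₀ hb0]
    rw [hεδ] at ht
    nlinarith
  have h5 : t * (δ / b) * (1 - δ) ≤ m * (δ / (1 - δ)) := by
    calc t * (δ / b) * (1 - δ) = t * (δ / b) - t * (δ ^ 2 / b) := by ring
      _ ≤ t * (δ / b) - Real.log n := by linarith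
      _ ≤ _ := hm
  have h6 : t * (1 - δ) ^ 2 ≤ b * m := by
    have h7 : t * (δ / b) * (1 - δ) * (b * (1 - δ) / δ) ≤ m * (δ / (1 - δ)) * (b * (1 - δ) / δ) :=
      mul_le_mul_of_nonneg_right h5 (by positivity)
    have h8 : t * (δ / b) * (1 - δ) * (b * (1 - δ) / δ) = t * (1 - δ) ^ 2 := by field_simp
    have h9 : m * (δ / (1 - δ)) * (b * (1 - δ) / δ) = b * m := by field_simp
    linarith
  have h10 : 1 ≤ (1 + 4 * δ) * (1 - δ) ^ 2 := by nlinarith [mul_pos hδ0 hδ0]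
  calc (t : ℝ) ≤ t * ((1 + 4 * δ) * (1 - δ) ^ 2) := le_mul_of_one_le_right (Nat.cast_nonneg t) h10
    _ = (1 + ε) * (t * (1 - δ) ^ 2) := by rw [hεδ]; ring
    _ ≤ (1 + ε) * (b * m) := by gcongr
    _ = _ := by ring

/-- Averaging over `A`: the loads of the elements of `A` add up to at most `t * rk A`. -/
lemma coveringNumber_le_inv_minRelLoad (hE : M.E = E) (t : ℕ) :
    coveringNumber M ≤ (minRelLoad M (greedySeq M E t))⁻¹ := by
  refine iSup_le fun A => iSup_le fun _ => iSup_le fun hA => ?_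
  set μ := minRelLoad M (greedySeq M E t)
  rw [← coe_rankOracle, ENat.toENNReal_coe, ENNReal.le_inv_iff_mul_le]
  have h1 : (A.card : ℝ≥0∞) * μ ≤ rankOracle M A := by
    calc (A.card : ℝ≥0∞) * μ = ∑ e ∈ A, μ := by rw [Finset.sum_const, nsmul_eq_mul]
      _ ≤ ∑ e ∈ A, relLoad (greedySeq M E t) e :=
          Finset.sum_le_sum fun e he => iInf₂_le e (hA he)
      _ = ((∑ e ∈ A, load (greedySeq M E t) e : ℕ) : ℝ≥0∞) / t := by
          simp only [relLoad, length_greedySeq, div_eq_mul_inv]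
          rw [← Finset.sum_mul, Nat.cast_sum]
      _ ≤ ((t * rankOracle M A : ℕ) : ℝ≥0∞) / t := by
          gcongr
          exact sum_load_greedySeq_le hE A t
      _ ≤ rankOracle M A := by
          rw [Nat.cast_mul]
          exact ENNReal.div_le_of_le_mul' le_rfl
  calc (A.card : ℝ≥0∞) / rankOracle M A * μ = (A.card * μ) / rankOracle M A := by
        simp only [div_eq_mul_inv]; ring
    _ ≤ rankOracle M A / rankOracle M A := by gcongr
    _ ≤ 1 := ENNReal.div_self_le_one

lemma inv_minRelLoad_le (hE : M.E = E) {ε βmax : ℝ} (hε0 : 0 < ε) (hε1 : ε < 1 / 2) {n t : ℕ}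
    (hn : E.card ≤ n) (hβ : coveringNumber M ≤ ENNReal.ofReal βmax) (ht0 : t ≠ 0)
    (ht : 16 * βmax * Real.log n / ε ^ 2 ≤ t) :
    (minRelLoad M (greedySeq M E t))⁻¹ ≤ ENNReal.ofReal (1 + ε) * coveringNumber M := by
  have htop : coveringNumber M ≠ ⊤ := ne_top_of_le_ne_top ENNReal.ofReal_ne_top hβ
  rw [ENNReal.inv_le_iff_inv_le]
  refine le_iInf₂ fun e he => ?_
  have he' : e ∈ E := by rwa [hE] at he
  have hb1 := one_le_toReal_coveringNumber hE htop ⟨e, he'⟩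
  have hb := toReal_coveringNumber_le hE ⟨e, he'⟩ hβ
  have hlog : 0 ≤ Real.log n := Real.log_natCast_nonneg n
  have ht' : 16 * (coveringNumber M).toReal * Real.log n / ε ^ 2 ≤ t :=
    le_trans (by gcongr) ht
  have hmain := le_mul_load_greedySeq hE hb1 hε0 hε1
    (fun A hA => card_le_toReal_coveringNumber_mul hE htop hA) hn ht' he'
  have hmain' : (t : ℝ≥0∞) ≤
      ENNReal.ofReal (1 + ε) * coveringNumber M * load (greedySeq M E t) e := by
    have h := ENNReal.ofReal_le_ofReal hmain
    rwa [ENNReal.ofReal_mul (by positivity), ENNReal.ofReal_mul (by positivity),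
      ENNReal.ofReal_toReal htop, ENNReal.ofReal_natCast, ENNReal.ofReal_natCast] at h
  rw [relLoad, length_greedySeq, ENNReal.le_div_iff_mul_le
    (Or.inl (by exact_mod_cast ht0)) (Or.inl (ENNReal.natCast_ne_top _)), mul_comm,
    ← div_eq_mul_inv]
  exact ENNReal.div_le_of_le_mul' hmain'

end seq

/-! ### Recourse of the greedy sequence under the deletion of an element -/

/-- The elements of `E` whose weight differs in the two weightings. -/
noncomputable def changed {α : Type u} (E : Finset α) (w w' : α → ℕ) : Finset α :=
  E.filter (fun f => w f ≠ w' f)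

section recourse
variable {α : Type u} [DecidableEq α] {M : Matroid α} {E : Finset α} {e : α}

lemma delete_ground_eq (hE : M.E = E) (e : α) :
    (M.delete {e}).E = (E.erase e : Finset α) := by
  rw [Matroid.delete_ground, hE, Finset.coe_erase]

/-- If the weights of all other elements do not decrease, a chosen element of unchanged weight
remains chosen after the deletion of `e`: it has fewer predecessors. -/
lemma mem_greedyBase_delete {w w' : α → ℕ}
    (hw : ∀ f ∈ E.erase e, w f ≤ w' f) {f : α} (hfe : f ≠ e) (hwf : w f = w' f)
    (hf : f ∈ greedyBase M E w) : f ∈ greedyBase (M.delete {e}) (E.erase e) w' := by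
  rw [mem_greedyBase] at hf ⊢
  refine ⟨Finset.mem_erase.2 ⟨hfe, hf.1⟩, fun hcl => hf.2 ?_⟩
  rw [Matroid.delete_closure_eq] at hcl
  refine M.closure_subset_closure ?_ hcl.1
  rintro g ⟨hg, -⟩
  have hg := mem_preds.1 hg
  have hwg := hw g hg.1
  refine mem_preds.2 ⟨Finset.mem_of_mem_erase hg.1, ?_⟩
  rcases hg.2 with h | ⟨h, hr⟩
  · exact Or.inl (by omega)
  · rcases hwg.lt_or_eq with h' | h'
    · exact Or.inl (by omega)
    · exact Or.inr ⟨by omega, hr⟩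

lemma load_le_load_delete (i : ℕ) : ∀ f ∈ E.erase e,
    load (greedySeq M E i) f ≤ load (greedySeq (M.delete {e}) (E.erase e) i) f := by
  induction i with
  | zero => simp [greedySeq]
  | succ i ih =>
    intro f hf
    rw [load_greedySeq_succ, load_greedySeq_succ]
    rcases (ih f hf).lt_or_eq with h | h
    · split_ifs <;> omega
    · by_cases hfB : f ∈ greedyBase M E (load (greedySeq M E i))
      · rw [if_pos hfB, if_pos (mem_greedyBase_delete ih (Finset.ne_of_mem_erase hf) h hfB), h]
      · rw [if_neg hfB]
        omega

lemma rankOracle_delete_le (hE : M.E = E) (e : α) :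
    rankOracle (M.delete {e}) (E.erase e) ≤ rankOracle M E := by
  rw [← card_greedyBase (w := fun _ => 0) (delete_ground_eq hE e)]
  refine card_le_rankOracle ?_ (greedyBase_subset.trans (Finset.erase_subset _ _))
  exact (greedyBase_indep (delete_ground_eq hE e)).of_delete

/-- The loads off `e` only grow, and by no more in total than `e` has lost; hence at most `i`
loads change in the first `i` bases. -/
lemma card_changed_le (hE : M.E = E) (he : e ∈ E) (i : ℕ) :
    (changed (E.erase e) (load (greedySeq M E i))
      (load (greedySeq (M.delete {e}) (E.erase e) i))).card ≤ i := by
  set w := load (greedySeq M E i)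
  set w' := load (greedySeq (M.delete {e}) (E.erase e) i)
  have hw : ∀ f ∈ E.erase e, w f ≤ w' f := load_le_load_delete i
  have h1 : (changed (E.erase e) w w').card + ∑ f ∈ E.erase e, w f ≤ ∑ f ∈ E.erase e, w' f := by
    rw [changed, Finset.card_filter, ← Finset.sum_add_distrib]
    refine Finset.sum_le_sum fun f hf => ?_
    have := hw f hf
    split_ifs <;> omega
  have h2 : ∑ f ∈ E, w f = i * rankOracle M E := sum_load_greedySeq hE i
  have h3 : ∑ f ∈ E.erase e, w' f = i * rankOracle (M.delete {e}) (E.erase e) :=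
    sum_load_greedySeq (delete_ground_eq hE e) i
  have h4 := Nat.mul_le_mul_left i (rankOracle_delete_le hE e)
  have h5 := Finset.sum_erase_add E w he
  have h6 : w e ≤ i := by
    have : w e ≤ (greedySeq M E i).length := List.countP_le_length
    rwa [length_greedySeq] at this
  omega

end recourse


/-! ### Rank query procedures -/

namespace RankProc

/-- Run `p`, then continue with its result. -/
def bind {α σ τ : Type u} : RankProc α σ → (σ → RankProc α τ) → RankProc α τ
  | .done s, q => q s
  | .query A next, q => .query A (fun ρ => (next ρ).bind q)

lemma result_bind {α σ τ : Type u} (r : Finset α → ℕ) (p : RankProc α σ) (q : σ → RankProc α τ) :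
    (p.bind q).result r = (q (p.result r)).result r := by
  induction p with
  | done s => rfl
  | query A next ih => exact ih (r A)

lemma queries_bind {α σ τ : Type u} (r : Finset α → ℕ) (p : RankProc α σ) (q : σ → RankProc α τ) :
    (p.bind q).queries r = p.queries r + (q (p.result r)).queries r := by
  induction p with
  | done s => simp [bind, queries, result]
  | query A next ih =>
    simp only [bind, queries, result, ih (r A)]
    ring

open Classical in
/-- Binary search with `k` queries for the least `j` in `[lo, lo + 2 ^ k)` for which the rank of
`Q j` passes the test; the search continues with `cont j`. -/
noncomputable def findFirst {α σ : Type u} (Q : ℕ → Finset α) (test : ℕ → ℕ → Prop)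
    (cont : ℕ → RankProc α σ) : ℕ → ℕ → RankProc α σ
  | 0, lo => cont lo
  | k + 1, lo => .query (Q (lo + 2 ^ k - 1)) (fun ρ =>
      if test (lo + 2 ^ k - 1) ρ then findFirst Q test cont k lo
      else findFirst Q test cont k (lo + 2 ^ k))

lemma result_findFirst {α σ : Type u} {Q : ℕ → Finset α} {test : ℕ → ℕ → Prop}
    {cont : ℕ → RankProc α σ} {r : Finset α → ℕ} {j₀ : ℕ}
    (h : ∀ j, test j (r (Q j)) ↔ j₀ ≤ j) (k lo : ℕ) (hlo : lo ≤ j₀) (hhi : j₀ < lo + 2 ^ k) :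
    (findFirst Q test cont k lo).result r = (cont j₀).result r := by
  induction k generalizing lo with
  | zero =>
    have : lo = j₀ := by simp at hhi; omega
    rw [this, findFirst]
  | succ k ih =>
    have hpos : 0 < 2 ^ k := by positivity
    rw [findFirst, result]
    rw [pow_succ] at hhi
    split_ifs with ht
    · rw [h] at ht
      exact ih lo hlo (by omega)
    · rw [h] at ht
      exact ih _ (by omega) (by omega)

lemma queries_findFirst_le {α σ : Type u} {Q : ℕ → Finset α} {test : ℕ → ℕ → Prop}
    {cont : ℕ → RankProc α σ} {r : Finset α → ℕ} {c : ℕ}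
    (h : ∀ j, (cont j).queries r ≤ c) (k lo : ℕ) :
    (findFirst Q test cont k lo).queries r ≤ k + c := by
  induction k generalizing lo with
  | zero => simpa [findFirst] using h lo
  | succ k ih =>
    rw [findFirst, queries]
    split_ifs
    · have := ih lo
      omega
    · have := ih (lo + 2 ^ k)
      omega

end RankProc

/-- The elements of `E` up to and including position `j`. -/
noncomputable def initSeg {α : Type u} (E : Finset α) (w : α → ℕ) (j : ℕ) : Finset α :=
  E.filter (fun f => pos E w f ≤ j)

open Classical in
/-- Enlarge a subset `I` of the greedy base by at most `s` elements, always by the first element in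
weight order that is not spanned; each is located by binary search. -/
noncomputable def completeProc {α : Type u} [DecidableEq α] (E : Finset α) (w : α → ℕ) (k : ℕ) :
    ℕ → Finset α → RankProc α (Finset α)
  | 0, I => .done I
  | s + 1, I => .query E (fun ρ =>
      if ρ ≤ I.card then .done I
      else .findFirst (fun j => I ∪ initSeg E w j) (fun _ ρ' => I.card < ρ')
        (fun j => completeProc E w k s (I ∪ E.filter (fun f => pos E w f = j))) k 0)

open Classical in
/-- Remove from a superset `S` of the greedy base at most `s` elements, always the first element in
weight order that depends on its predecessors in `S`; each is located by binary search. -/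
noncomputable def pruneProc {α : Type u} (E : Finset α) (w : α → ℕ) (k : ℕ) :
    ℕ → Finset α → RankProc α (Finset α)
  | 0, S => .done S
  | s + 1, S => .query S (fun ρ =>
      if S.card ≤ ρ then .done S
      else .findFirst (fun j => S.filter (fun f => pos E w f ≤ j))
        (fun j ρ' => ρ' < (S.filter (fun f => pos E w f ≤ j)).card)
        (fun j => pruneProc E w k s (S.filter (fun f => pos E w f ≠ j))) k 0)

/-- Compute a given number of bases one after the other, each from the list of the bases before. -/
def listProc {α : Type u} (step : List (Finset α) → RankProc α (Finset α)) :
    ℕ → RankProc α (List (Finset α))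
  | 0 => .done []
  | i + 1 => (listProc step i).bind (fun N => (step N).bind (fun B => .done (N ++ [B])))

section proc
variable {α : Type u} {M : Matroid α} {E : Finset α} {w : α → ℕ} {k : ℕ}

lemma queries_completeProc_le [DecidableEq α] (r : Finset α → ℕ) (s : ℕ) (I : Finset α) :
    (completeProc E w k s I).queries r ≤ s * (k + 1) := by
  induction s generalizing I with
  | zero => simp [completeProc, RankProc.queries]
  | succ s ih =>
    rw [completeProc, RankProc.queries, Nat.succ_mul]
    split_ifs
    · simp only [RankProc.queries]
      omega
    · have := RankProc.queries_findFirst_le (Q := fun j => I ∪ initSeg E w j)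
        (test := fun _ ρ' => I.card < ρ') (r := r)
        (fun j => ih (I ∪ E.filter (fun f => pos E w f = j))) k 0
      omega

lemma queries_pruneProc_le (r : Finset α → ℕ) (s : ℕ) (S : Finset α) :
    (pruneProc E w k s S).queries r ≤ s * (k + 1) := by
  induction s generalizing S with
  | zero => simp [pruneProc, RankProc.queries]
  | succ s ih =>
    rw [pruneProc, RankProc.queries, Nat.succ_mul]
    split_ifs
    · simp only [RankProc.queries]
      omega
    · have := RankProc.queries_findFirst_le (Q := fun j => S.filter (fun f => pos E w f ≤ j))
        (test := fun j ρ' => ρ' < (S.filter (fun f => pos E w f ≤ j)).card) (r := r)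
        (fun j => ih (S.filter (fun f => pos E w f ≠ j))) k 0
      omega

lemma result_completeProc [DecidableEq α] (hE : M.E = E) (hk : E.card ≤ 2 ^ k) (s : ℕ)
    {I : Finset α} (hI : I ⊆ greedyBase M E w) (hs : (greedyBase M E w).card ≤ I.card + s) :
    (completeProc E w k s I).result (rankOracle M) = greedyBase M E w := by
  induction s generalizing I with
  | zero =>
    rw [completeProc, RankProc.result]
    exact Finset.eq_of_subset_of_card_le hI hs
  | succ s ih =>
    rw [completeProc, RankProc.result, ← card_greedyBase (w := w) hE]
    split_ifs with hc
    · exact Finset.eq_of_subset_of_card_le hI hc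
    have hne : (greedyBase M E w \ I).Nonempty := by
      rw [Finset.sdiff_nonempty]
      exact fun h => hc (Finset.card_le_card h)
    obtain ⟨f, hf, hmin⟩ := Finset.exists_min_image _ (pos E w) hne
    obtain ⟨hfB, hfI⟩ := Finset.mem_sdiff.1 hf
    have hfE := greedyBase_subset hfB
    have hIB : insert f I ⊆ greedyBase M E w := Finset.insert_subset hfB hI
    have hsing : I ∪ E.filter (fun g => pos E w g = pos E w f) = insert f I := by
      ext g
      simp only [Finset.mem_union, Finset.mem_filter, Finset.mem_insert]
      refine ⟨?_, ?_⟩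
      · rintro (h | ⟨h, h'⟩)
        · exact Or.inr h
        · exact Or.inl (pos_injOn h hfE h')
      · rintro (rfl | h)
        · exact Or.inr ⟨hfE, rfl⟩
        · exact Or.inl h
    rw [RankProc.result_findFirst (j₀ := pos E w f) ?_ k 0 (Nat.zero_le _)
      (by have := pos_lt_card (w := w) hfE; omega), hsing]
    · refine ih hIB ?_
      rw [Finset.card_insert_of_notMem hfI]
      omega
    · intro j
      refine ⟨fun h => ?_, fun h => ?_⟩
      -- up to a position before `f`, everything is spanned by `I`
      · by_contra hj
        have hbas := greedyBase_inter_isBasis (w := w) hE (P := initSeg E w j)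
          (Finset.filter_subset _ _) (fun f hf g hg hgf => by
            rw [initSeg, Finset.mem_filter] at hf ⊢
            exact ⟨hg, (pos_lt_pos hg hgf).le.trans hf.2⟩)
        have hsub : (greedyBase M E w : Set α) ∩ initSeg E w j ⊆ I := by
          rintro g ⟨hgB, hgP⟩
          by_contra hgI
          have h1 := hmin g (Finset.mem_sdiff.2 ⟨hgB, hgI⟩)
          have h2 := (Finset.mem_filter.1 (Finset.mem_coe.1 hgP)).2
          omega
        have hIE : (I : Set α) ⊆ M.E := by
          rw [hE]
          exact Finset.coe_subset.2 (hI.trans greedyBase_subset)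
        have hcl : ((I ∪ initSeg E w j : Finset α) : Set α) ⊆ M.closure I := by
          rw [Finset.coe_union]
          exact Set.union_subset (M.subset_closure _ hIE)
            (hbas.subset_closure.trans (M.closure_subset_closure hsub))
        have hrk := M.eRk_mono hcl
        rw [Matroid.eRk_closure_eq, ← coe_rankOracle, ← coe_rankOracle] at hrk
        have hrk' : rankOracle M (I ∪ initSeg E w j) ≤ rankOracle M I := by exact_mod_cast hrk
        have := rankOracle_le_card M I
        omega
      · have h1 : (insert f I).card ≤ rankOracle M (I ∪ initSeg E w j) := by
          refine card_le_rankOracle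
            ((greedyBase_indep (w := w) hE).subset (Finset.coe_subset.2 hIB)) ?_
          refine Finset.insert_subset (Finset.mem_union_right _ ?_) Finset.subset_union_left
          exact Finset.mem_filter.2 ⟨hfE, h⟩
        rw [Finset.card_insert_of_notMem hfI] at h1
        omega

lemma result_pruneProc (hE : M.E = E) (hk : E.card ≤ 2 ^ k) (s : ℕ) {S : Finset α} (hSE : S ⊆ E)
    (hS : greedyBase M E w ⊆ S) (hs : S.card ≤ (greedyBase M E w).card + s) :
    (pruneProc E w k s S).result (rankOracle M) = greedyBase M E w := by
  classical
  induction s generalizing S with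
  | zero =>
    rw [pruneProc, RankProc.result]
    exact (Finset.eq_of_subset_of_card_le hS hs).symm
  | succ s ih =>
    have hrS : rankOracle M S = (greedyBase M E w).card := by
      refine le_antisymm ?_ (card_le_rankOracle (greedyBase_indep hE) hS)
      rw [card_greedyBase hE]
      exact rankOracle_mono M hSE
    rw [pruneProc, RankProc.result, hrS]
    split_ifs with hc
    · exact (Finset.eq_of_subset_of_card_le hS hc).symm
    have hne : (S \ greedyBase M E w).Nonempty := by
      rw [Finset.sdiff_nonempty]
      exact fun h => hc (Finset.card_le_card h)
    obtain ⟨f, hf, hmin⟩ := Finset.exists_min_image _ (pos E w) hne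
    obtain ⟨hfS, hfB⟩ := Finset.mem_sdiff.1 hf
    have hfE := hSE hfS
    have hsing : S.filter (fun g => pos E w g ≠ pos E w f) = S.erase f := by
      ext g
      simp only [Finset.mem_filter, Finset.mem_erase]
      refine ⟨fun h => ⟨fun h' => h.2 (h' ▸ rfl), h.1⟩, fun h => ⟨h.2, fun h' => h.1 ?_⟩⟩
      exact pos_injOn (hSE h.2) hfE h'
    rw [RankProc.result_findFirst (j₀ := pos E w f) ?_ k 0 (Nat.zero_le _)
      (by have := pos_lt_card (w := w) hfE; omega), hsing]
    · refine ih ((Finset.erase_subset _ _).trans hSE) ?_ ?_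
      · exact fun g hg => Finset.mem_erase.2 ⟨fun h => hfB (h ▸ hg), hS hg⟩
      · rw [Finset.card_erase_of_mem hfS]
        omega
    · intro j
      refine ⟨fun h => ?_, fun h => ?_⟩
      -- up to a position before `f`, the set `S` agrees with the greedy base
      · by_contra hj
        refine absurd h (not_lt.2 (card_le_rankOracle
          ((greedyBase_indep (w := w) hE).subset ?_) (Finset.Subset.refl _)))
        intro g hg
        obtain ⟨hgS, hgj⟩ := Finset.mem_filter.1 (Finset.mem_coe.1 hg)
        by_contra hgB
        have h1 := hmin g (Finset.mem_sdiff.2 ⟨hgS, hgB⟩)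
        omega
      -- `f` is spanned by the greedy base elements before it, which all lie in `S`
      · set T := S.filter (fun g => pos E w g ≤ j) with hT
        have hfT : f ∈ T := Finset.mem_filter.2 ⟨hfS, h⟩
        have hTE : (T.erase f : Set α) ⊆ M.E := by
          rw [hE]
          exact Finset.coe_subset.2 ((Finset.erase_subset _ _).trans
            ((Finset.filter_subset _ _).trans hSE))
        have hfcl : f ∈ M.closure (T.erase f : Finset α) := by
          have hbas := greedyBase_inter_isBasis (w := w) hE (P := preds E w f)
            (fun g hg => (mem_preds.1 hg).1)
            (fun g hg g' hg' hgg' => mem_preds.2 ⟨hg', hgg'.trans (mem_preds.1 hg).2⟩)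
          have h1 : f ∈ M.closure (preds E w f : Set α) := by
            by_contra hcl
            exact hfB (mem_greedyBase.2 ⟨hfE, hcl⟩)
          rw [← hbas.closure_eq_closure] at h1
          refine M.closure_subset_closure ?_ h1
          rintro g ⟨hgB, hgP⟩
          have hgP := mem_preds.1 hgP
          refine Finset.mem_erase.2 ⟨fun hgf => hfB (hgf ▸ hgB), Finset.mem_filter.2 ⟨hS hgB, ?_⟩⟩
          exact (pos_lt_pos hgP.1 hgP.2).le.trans h
        have hcl : (T : Set α) ⊆ M.closure (T.erase f : Finset α) := by
          intro g hg
          by_cases hgf : g = f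
          · exact hgf ▸ hfcl
          · exact M.subset_closure _ hTE (Finset.mem_erase.2 ⟨hgf, hg⟩)
        have hrk := M.eRk_mono hcl
        rw [Matroid.eRk_closure_eq, ← coe_rankOracle, ← coe_rankOracle] at hrk
        have hrk' : rankOracle M T ≤ rankOracle M (T.erase f) := by exact_mod_cast hrk
        have h2 := rankOracle_le_card M (T.erase f)
        have h3 := Finset.card_erase_lt_of_mem hfT
        omega

lemma result_listProc [DecidableEq α] {step : List (Finset α) → RankProc α (Finset α)} {t : ℕ}
    (h : ∀ i < t, (step (greedySeq M E i)).result (rankOracle M) =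
      greedyBase M E (load (greedySeq M E i))) :
    (listProc step t).result (rankOracle M) = greedySeq M E t := by
  induction t with
  | zero => rfl
  | succ t ih =>
    rw [listProc, RankProc.result_bind, RankProc.result_bind,
      ih (fun i hi => h i (hi.trans (Nat.lt_succ_self t))), h t (Nat.lt_succ_self t)]
    rfl

lemma queries_listProc_le {step : List (Finset α) → RankProc α (Finset α)} {r : Finset α → ℕ}
    {c : ℕ} (h : ∀ N, (step N).queries r ≤ (N.length + 1) * c) (t : ℕ) :
    ((listProc step t).result r).length = t ∧ (listProc step t).queries r ≤ t * t * c := by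
  induction t with
  | zero => exact ⟨rfl, Nat.zero_le _⟩
  | succ t ih =>
    refine ⟨?_, ?_⟩
    · rw [listProc, RankProc.result_bind, RankProc.result_bind]
      simp [RankProc.result, ih.1]
    · rw [listProc, RankProc.queries_bind, RankProc.queries_bind]
      have h1 := h ((listProc step t).result r)
      rw [ih.1] at h1
      simp only [RankProc.queries, add_zero]
      nlinarith [ih.2, Nat.zero_le (t * c)]

end proc


/-! ### The dynamic algorithm -/

/-- The ground set after an update. -/
def Update.ground {α : Type u} [DecidableEq α] : Update α → Finset α → Finset α
  | .insert e, E => Insert.insert e E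
  | .delete e, E => E.erase e

/-- Update a greedy sequence `O` of bases on the ground set `E`: the bases `N` found so far for the
new matroid determine the next weights. After an insertion, the next base is contained in the old
one together with the new element and the elements of changed weight; after a deletion, it contains
the old one except for these. -/
noncomputable def updateProc {α : Type u} [DecidableEq α] (t k : ℕ) (E : Finset α)
    (O : List (Finset α)) : Update α → RankProc α (List (Finset α))
  | .insert e => listProc (fun N =>
      pruneProc (Insert.insert e E) (load N) k (N.length + 1)
        (Insert.insert e
          (O.getD N.length ∅ ∪ changed E (load N) (load (O.take N.length))))) t
  | .delete e => listProc (fun N =>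
      completeProc (E.erase e) (load N) k (N.length + 1)
        (O.getD N.length ∅ \
          Insert.insert e (changed (E.erase e) (load (O.take N.length)) (load N)))) t

/-- The algorithm that maintains the ground set and the first `t` greedy bases. If `n ≤ 1`, no
queries may be made: the logarithm of `n` vanishes; then the ground set itself is the base. -/
noncomputable def algorithm (α : Type u) [DecidableEq α] (n t : ℕ) : DynAlgorithm α where
  State := Finset α × List (Finset α)
  init E := (listProc (fun N => completeProc E (load N) E.card E.card ∅) t).bind
    (fun N => .done (E, N))
  update s U := if n ≤ 1 then .done (U.ground s.1, [U.ground s.1]) else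
    (updateProc t (Nat.clog 2 n) s.1 s.2 U).bind (fun N => .done (U.ground s.1, N))
  collection s := s.2
  value s := ((⨅ e ∈ (s.1 : Set α), relLoad s.2 e)⁻¹).toNNReal

section algorithm
variable {α : Type u} [DecidableEq α] {M M' : Matroid α} {E : Finset α} {n t k : ℕ}

lemma Update.Step.ground_eq {U : Update α} (hU : U.Step M M') (hE : M.E = E) :
    M'.E = (U.ground E : Finset α) := by
  cases U with
  | insert e =>
    rw [hU.2.1, hE, Update.ground, Finset.coe_insert, Set.union_singleton]
  | delete e =>
    rw [hU.2, delete_ground_eq hE]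
    rfl

lemma getD_greedySeq {i : ℕ} (h : i < t) :
    (greedySeq M E t).getD i ∅ = greedyBase M E (load (greedySeq M E i)) := by
  have h' : i < (greedySeq M E t).length := by rwa [length_greedySeq]
  rw [List.getD_eq_getElem _ _ h', getElem_greedySeq]

lemma result_updateProc_delete (hE : M.E = E) {e : α} (he : e ∈ E) (hk : E.card ≤ 2 ^ k) :
    (updateProc t k E (greedySeq M E t) (.delete e)).result (rankOracle (M.delete {e})) =
      greedySeq (M.delete {e}) (E.erase e) t := by
  refine result_listProc fun i hi => ?_
  rw [length_greedySeq, getD_greedySeq hi, take_greedySeq hi.le]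
  have hE' := delete_ground_eq hE e
  refine result_completeProc hE' ((Finset.card_erase_le).trans hk) _ ?_ ?_
  · intro f hf
    simp only [Finset.mem_sdiff, Finset.mem_insert, not_or, changed, Finset.mem_filter,
      not_and, not_not] at hf
    obtain ⟨hfB, hfe, hfw⟩ := hf
    exact mem_greedyBase_delete (load_le_load_delete i) hfe
      (hfw (Finset.mem_erase.2 ⟨hfe, greedyBase_subset hfB⟩)) hfB
  · have h1 := card_changed_le hE he i
    have h2 := rankOracle_delete_le hE e
    rw [card_greedyBase hE']
    rw [← card_greedyBase (w := load (greedySeq M E i)) hE] at h2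
    have h3 := Finset.le_card_sdiff (Insert.insert e (changed (E.erase e) (load (greedySeq M E i))
      (load (greedySeq (M.delete {e}) (E.erase e) i)))) (greedyBase M E (load (greedySeq M E i)))
    have h4 := Finset.card_insert_le e (changed (E.erase e) (load (greedySeq M E i))
      (load (greedySeq (M.delete {e}) (E.erase e) i)))
    omega

lemma result_updateProc_insert {e : α} (he : e ∉ E) (hE' : M'.E = (Insert.insert e E : Finset α))
    (hk : (Insert.insert e E).card ≤ 2 ^ k) :
    (updateProc t k E (greedySeq (M'.delete {e}) E t) (.insert e)).result (rankOracle M') =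
      greedySeq M' (Insert.insert e E) t := by
  refine result_listProc fun i hi => ?_
  rw [length_greedySeq, getD_greedySeq hi, take_greedySeq hi.le]
  have hera : (Insert.insert e E).erase e = E := Finset.erase_insert he
  have hE : (M'.delete {e}).E = E := by rw [delete_ground_eq hE', hera]
  have hmono := load_le_load_delete (M := M') (E := Insert.insert e E) (e := e) i
  have hcard := card_changed_le hE' (Finset.mem_insert_self e E) i
  have hrank := rankOracle_delete_le hE' e
  rw [hera] at hmono hcard hrank
  refine result_pruneProc hE' hk _ ?_ ?_ ?_
  · refine Finset.insert_subset_insert _ (Finset.union_subset greedyBase_subset ?_)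
    exact Finset.filter_subset _ _
  · intro f hf
    by_cases hfe : f = e
    · exact hfe ▸ Finset.mem_insert_self _ _
    refine Finset.mem_insert_of_mem (Finset.mem_union.2 ?_)
    have hfE : f ∈ E := (Finset.mem_insert.1 (greedyBase_subset hf)).resolve_left hfe
    by_cases hw : load (greedySeq M' (Insert.insert e E) i) f =
        load (greedySeq (M'.delete {e}) E i) f
    · left
      have := mem_greedyBase_delete (e := e)
        (w' := load (greedySeq (M'.delete {e}) E i)) (by rwa [hera]) hfe hw hf
      rwa [hera] at this
    · exact Or.inr (Finset.mem_filter.2 ⟨hfE, hw⟩)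
  · rw [card_greedyBase hE']
    rw [← card_greedyBase (w := load (greedySeq (M'.delete {e}) E i)) hE] at hrank
    refine (Finset.card_insert_le _ _).trans ?_
    have := Finset.card_union_le
      (greedyBase (M'.delete {e}) E (load (greedySeq (M'.delete {e}) E i)))
      (changed E (load (greedySeq M' (Insert.insert e E) i)) (load (greedySeq (M'.delete {e}) E i)))
    omega

lemma result_updateProc {U : Update α} (hU : U.Step M M') (hE : M.E = E) (hk : E.card ≤ 2 ^ k)
    (hk' : (U.ground E).card ≤ 2 ^ k) :
    (updateProc t k E (greedySeq M E t) U).result (rankOracle M') =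
      greedySeq M' (U.ground E) t := by
  cases U with
  | insert e =>
    have hg := hU.ground_eq hE
    obtain ⟨he, -, rfl⟩ := hU
    rw [hE, Finset.mem_coe] at he
    exact result_updateProc_insert he hg hk'
  | delete e =>
    obtain ⟨he, rfl⟩ := hU
    rw [hE, Finset.mem_coe] at he
    exact result_updateProc_delete hE he hk

lemma queries_updateProc_le (r : Finset α → ℕ) (O : List (Finset α)) (U : Update α) :
    (updateProc t k E O U).queries r ≤ t * t * (k + 1) := by
  cases U with
  | insert e => exact (queries_listProc_le (fun N => queries_pruneProc_le r _ _) t).2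
  | delete e => exact (queries_listProc_le (fun N => queries_completeProc_le r _ _) t).2

/-- As long as the matroids are within the promised bounds, the state consists of the current ground
set and its canonical greedy sequence. -/
lemma exists_stateAt_eq (ht : n ≤ 1 → t = 1) {j : ℕ} {E₀ : Finset α} {M : ℕ → Matroid α}
    {U : ℕ → Update α} (h0 : (M 0).E = (E₀ : Set α))
    (hU : ∀ i < j, (U i).Step (M i) (M (i + 1)))
    (hM : ∀ i ≤ j, (M i).E.encard ≤ n ∧ coveringNumber (M i) ≠ ⊤) (i : ℕ) (hi : i ≤ j) :
    ∃ E : Finset α, (M i).E = E ∧ E.card ≤ n ∧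
      (algorithm α n t).stateAt E₀ M U i = (E, greedySeq (M i) E t) := by
  have hcard : ∀ i ≤ j, ∀ E : Finset α, (M i).E = E → E.card ≤ n := by
    intro i hi E hE
    have h := (hM i hi).1
    rw [hE, Set.encard_coe_eq_coe_finsetCard] at h
    exact_mod_cast h
  induction i with
  | zero =>
    refine ⟨E₀, h0, hcard 0 hi E₀ h0, ?_⟩
    change ((listProc (fun N => completeProc E₀ (load N) E₀.card E₀.card ∅) t).bind
      (fun N => RankProc.done (E₀, N))).result (rankOracle (M 0)) = _
    rw [RankProc.result_bind, result_listProc (M := M 0) (E := E₀)]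
    · rfl
    · intro i _
      refine result_completeProc h0 Nat.lt_two_pow_self.le _ (Finset.empty_subset _) ?_
      rw [Finset.card_empty, zero_add]
      exact Finset.card_le_card greedyBase_subset
  | succ i ih =>
    obtain ⟨E, hE, hEn, hs⟩ := ih (by omega)
    have hE' := (hU i hi).ground_eq hE
    have hEn' := hcard _ hi _ hE'
    refine ⟨(U i).ground E, hE', hEn', ?_⟩
    rw [DynAlgorithm.stateAt, hs]
    simp only [algorithm]
    split_ifs with hn
    · rw [ht hn]
      simp only [RankProc.result, greedySeq, List.nil_append]
      rw [greedyBase_eq_ground_of_card_le_one hE' (hM _ hi).2 (hEn'.trans hn)]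
    · have hpow : n ≤ 2 ^ Nat.clog 2 n := Nat.le_pow_clog one_lt_two n
      rw [RankProc.result_bind, result_updateProc (hU i hi) hE (hEn.trans hpow)
        (hEn'.trans hpow)]
      rfl

lemma Update.Step.one_le_of_coveringNumber_le {U : Update α} (hU : U.Step M M') (hE : M.E = E)
    {βmax : ℝ} (hβ : coveringNumber M ≤ ENNReal.ofReal βmax)
    (hβ' : coveringNumber M' ≤ ENNReal.ofReal βmax) : 1 ≤ βmax := by
  have key : ∀ (N : Matroid α) (F : Finset α), N.E = F → F.Nonempty →
      coveringNumber N ≤ ENNReal.ofReal βmax → 1 ≤ βmax := fun N F hF hne hN =>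
    (one_le_toReal_coveringNumber hF (ne_top_of_le_ne_top ENNReal.ofReal_ne_top hN) hne).trans
      (toReal_coveringNumber_le hF hne hN)
  cases U with
  | insert e =>
    exact key M' _ (hU.ground_eq hE) ⟨e, Finset.mem_insert_self e E⟩ hβ'
  | delete e =>
    have he := hU.1
    rw [hE, Finset.mem_coe] at he
    exact key M E hE ⟨e, he⟩ hβ

lemma queriesAt_algorithm_le {E₀ : Finset α} {M : ℕ → Matroid α} {U : ℕ → Update α} (i : ℕ) :
    (algorithm α n t).queriesAt E₀ M U i ≤ if n ≤ 1 then 0 else t * t * (Nat.clog 2 n + 1) := by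
  rw [DynAlgorithm.queriesAt]
  generalize (algorithm α n t).stateAt E₀ M U i = s
  simp only [algorithm]
  split_ifs with hn
  · simp [RankProc.queries]
  · rw [RankProc.queries_bind]
    simpa [RankProc.queries] using queries_updateProc_le _ _ _

end algorithm

/-! ### The number of bases and the query bound -/

/-- The length of the maintained greedy sequence. The summand `1` keeps the sequence nonempty when
the logarithm vanishes. -/
noncomputable def numBases (ε : ℝ) (n : ℕ) (βmax : ℝ) : ℕ :=
  ⌊16 * βmax * Real.log n / ε ^ 2⌋₊ + 1

lemma numBases_eq_one {ε βmax : ℝ} {n : ℕ} (hn : n ≤ 1) : numBases ε n βmax = 1 := by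
  interval_cases n <;> simp [numBases]

lemma clog_two_add_one_le {n : ℕ} (hn : 2 ≤ n) : (Nat.clog 2 n + 1 : ℝ) ≤ 5 * Real.log n := by
  have h1 : 2 ^ (Nat.clog 2 n - 1) < n := Nat.pow_pred_clog_lt_self one_lt_two (by omega)
  have h2 : 0 < Nat.clog 2 n := Nat.clog_pos one_lt_two hn
  have h3 : ((Nat.clog 2 n : ℝ) - 1) * Real.log 2 ≤ Real.log n := by
    have h := Real.log_le_log (by positivity) (by exact_mod_cast h1.le : (2 : ℝ) ^ _ ≤ (n : ℝ))
    rw [Real.log_pow, Nat.cast_sub h2] at h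
    exact_mod_cast h
  have h4 : Real.log 2 ≤ Real.log n := Real.log_le_log two_pos (by exact_mod_cast hn)
  have h5 := Real.log_two_gt_d9
  by_contra hlt
  have h6 : 5 * Real.log n * Real.log 2 < (Nat.clog 2 n + 1 : ℝ) * Real.log 2 :=
    mul_lt_mul_of_pos_right (not_le.1 hlt) (by linarith)
  nlinarith

lemma numBases_query_bound {ε βmax : ℝ} (hε0 : 0 < ε) (hε1 : ε < 1 / 2) (hβ : 1 ≤ βmax) {n : ℕ}
    (hn : 2 ≤ n) :
    ((numBases ε n βmax * numBases ε n βmax * (Nat.clog 2 n + 1) : ℕ) : ℝ) ≤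
      1445 * (βmax ^ 2 * (ε ^ 4)⁻¹ * Real.log n ^ 3) := by
  set X := βmax * Real.log n / ε ^ 2 with hX
  have hL : 0.69 ≤ Real.log n := by
    have h4 : Real.log 2 ≤ Real.log n := Real.log_le_log two_pos (by exact_mod_cast hn)
    have h5 := Real.log_two_gt_d9
    linarith
  have hX1 : 1 ≤ X := by
    rw [hX, le_div_iff₀ (by positivity), one_mul]
    nlinarith
  have ht : (numBases ε n βmax : ℝ) ≤ 17 * X := by
    have h1 : 16 * βmax * Real.log n / ε ^ 2 = 16 * X := by rw [hX]; ring
    have h2 : (⌊16 * X⌋₊ : ℝ) ≤ 16 * X := Nat.floor_le (by linarith)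
    rw [numBases, h1]
    push_cast
    linarith
  have hk := clog_two_add_one_le hn
  push_cast
  calc (numBases ε n βmax : ℝ) * numBases ε n βmax * (Nat.clog 2 n + 1)
      ≤ 17 * X * (17 * X) * (5 * Real.log n) := by gcongr
    _ = 1445 * (βmax ^ 2 * (ε ^ 4)⁻¹ * Real.log n ^ 3) := by
        rw [hX]
        field_simp
        ring

end DynMatroid

theorem mainTheorem2 :
    ∃ C : ℝ, 0 < C ∧
      ∀ (α : Type u) [DecidableEq α] (ε : ℝ), 0 < ε → ε < 1 / 2 →
      ∀ (n : ℕ) (βmax : ℝ),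
      ∃ 𝒜 : DynMatroid.DynAlgorithm α,
        ∀ (k : ℕ) (E₀ : Finset α) (M : ℕ → Matroid α) (U : ℕ → DynMatroid.Update α),
          (M 0).E = (E₀ : Set α) →
          (∀ i < k, (U i).Step (M i) (M (i + 1))) →
          (∀ i ≤ k, (M i).E.encard ≤ n ∧
            DynMatroid.coveringNumber (M i) ≤ ENNReal.ofReal βmax) →
          (∀ i ≤ k,
            ENNReal.ofReal (1 - ε) * DynMatroid.coveringNumber (M i)
                ≤ (𝒜.value (𝒜.stateAt E₀ M U i) : ℝ≥0∞) ∧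
            (𝒜.value (𝒜.stateAt E₀ M U i) : ℝ≥0∞)
                ≤ ENNReal.ofReal (1 + ε) * DynMatroid.coveringNumber (M i) ∧
            DynMatroid.IsGreedyBaseCollection (M i) (𝒜.collection (𝒜.stateAt E₀ M U i)) ∧
            (𝒜.value (𝒜.stateAt E₀ M U i) : ℝ≥0∞)
                = (DynMatroid.minRelLoad (M i) (𝒜.collection (𝒜.stateAt E₀ M U i)))⁻¹) ∧
          (∀ i < k, (𝒜.queriesAt E₀ M U i : ℝ)
              ≤ C * (βmax ^ 2 * (ε ^ 4)⁻¹ * Real.log n ^ 3)) := by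
  open DynMatroid in
  refine ⟨1445, by norm_num, fun α _ ε hε0 hε1 n βmax => ?_⟩
  have ht : 16 * βmax * Real.log n / ε ^ 2 ≤ numBases ε n βmax := by
    rw [numBases, Nat.cast_succ]
    exact (Nat.lt_floor_add_one _).le
  have ht0 : numBases ε n βmax ≠ 0 := Nat.succ_ne_zero _
  have ht1 : n ≤ 1 → numBases ε n βmax = 1 := numBases_eq_one
  have hqueries := fun hβ hn => numBases_query_bound (ε := ε) (βmax := βmax) hε0 hε1 hβ (n := n) hn
  generalize numBases ε n βmax = t at ht ht0 ht1 hqueries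
  refine ⟨algorithm α n t, fun k E₀ M U h0 hU hM => ?_⟩
  have htop : ∀ i ≤ k, coveringNumber (M i) ≠ ⊤ :=
    fun i hi => ne_top_of_le_ne_top ENNReal.ofReal_ne_top (hM i hi).2
  have hstate := exists_stateAt_eq ht1 h0 hU (fun i hi => ⟨(hM i hi).1, htop i hi⟩)
  refine ⟨fun i hi => ?_, fun i hi => ?_⟩
  · obtain ⟨E, hE, hEn, hs⟩ := hstate i hi
    have hlow := coveringNumber_le_inv_minRelLoad hE t
    have hupp := inv_minRelLoad_le hE hε0 hε1 hEn (hM i hi).2 ht0 ht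
    have hval : ((algorithm α n t).value ((algorithm α n t).stateAt E₀ M U i) : ℝ≥0∞) =
        (minRelLoad (M i) (greedySeq (M i) E t))⁻¹ := by
      rw [hs, minRelLoad, hE]
      refine ENNReal.coe_toNNReal ?_
      rw [minRelLoad, hE] at hupp
      exact ne_top_of_le_ne_top (ENNReal.mul_ne_top ENNReal.ofReal_ne_top (htop i hi)) hupp
    rw [hval]
    refine ⟨?_, hupp, ?_, ?_⟩
    · refine le_trans (mul_le_of_le_one_left' ?_) hlow
      exact ENNReal.ofReal_le_one.2 (by linarith)
    · rw [hs]
      exact greedySeq_isGreedyBaseCollection hE ht0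
    · rw [hs]
      rfl
  · have hq := queriesAt_algorithm_le (n := n) (t := t) (E₀ := E₀) (M := M) (U := U) i
    split_ifs at hq with hn
    · rw [Nat.le_zero.1 hq, Nat.cast_zero]
      have : 0 ≤ Real.log n := Real.log_natCast_nonneg n
      positivity
    · obtain ⟨E, hE, -, -⟩ := hstate i hi.le
      have hβ := (hU i hi).one_le_of_coveringNumber_le hE (hM i hi.le).2 (hM _ hi).2
      exact le_trans (by exact_mod_cast hq) (hqueries hβ (by omega))
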